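/- Let $K,L,M_k,N_k$ ($k=1,\dots,K$) be nonnegative integers. Let $H_{k,j}\in\mathbb{C}^{N_k\times M_j}$ and $\widehat G_k\in\mathbb{C}^{L\times M_k}$ be matrices, $\sigma_k>0$, $\epsilon_k>0$, and let $p_k,\iota_k$ be real numbers. For $Q=(Q_1,\dots,Q_K)$ with $Q_k\in\mathbb{C}^{M_k\times M_k}$ put $$V_k=H_{k,k}Q_kH_{k,k}^{\mathcal H},\quad R_{k,k}=\sum_{i\ne k}H_{k,i}Q_iH_{k,i}^{\mathcal H}+\sigma_k^2 I,\quad B_k=V_k+R_{k,k},\quad u_k(Q)=\mathrm{Tr}\{V_kB_k^{-1}\},\quad U(Q)=\sum_{k=1}^K u_k(Q).$$ Let $\mathcal{Q}_k$ be the set of Hermitian positive semidefinite $X\in\mathbb{C}^{M_k\times M_k}$ with $\mathrm{Tr}\{X\}\le p_k$ and $\mathrm{Tr}\{(\widehat G_k+\Delta)X(\widehat G_k+\Delta)^{\mathcal H}\}\le\iota_k$ for all $\Delta\in\mathbb{C}^{L\times M_k}$ with $\mathrm{Tr}\{\Delta\Delta^{\mathcal H}\}\le\epsilon_k^2$. The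 robust sum-MSE problem (P3) is to maximize $U(Q)$ subject to $Q_k\in\mathcal{Q}_k$ for all $k$. A point $\bar Q$ is called stationary for (P3) if $\bar Q_k\in\mathcal{Q}_k$ for all $k$ and $\Re\,\mathrm{Tr}\{\nabla_kU(\bar Q)^{\mathcal H}(X-\bar Q_k)\}\le 0$ for all $k$ and all $X\in\mathcal{Q}_k$, where $\nabla_k U$ is the gradient with respect to $Q_k$ for the real inner product $\Re\,\mathrm{Tr}\{G^{\mathcal H}Y\}$. The cyclic block-coordinate ascent algorithm with concave-convex procedure starts at a point $Q^{(0)}$ with $Q^{(0)}_k\in\mathcal{Q}_k$ for all $k$ (for instance $Q^{(0)}=0$, if it is feasible). In iteration $n=1,2,\dots$ it updates the blocks $k=1,\dots,K$ in this order: at the current point $\tilde Q=(Q_1^{(n)},\dots,Q_{k-1}^{(n)},Q_k^{(n-1)},\dots,Q_K^{(n-1)})$ it linearizes the part $f_k=\sum_{j\ne k}u_j$, which is convex in $Q_k$, with the gradient $$D_k=-\sum_{j\ne k}H_{j,k}^{\mathcal H}B_j^{-1}V_jB_j^{-1}H_{j,k}\Big|_{Q=\tilde Q},$$ and takes as $Q_k^{(n)}$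 a solution of $$\text{(P4)}\qquad \max_{X\in\mathcal{Q}_k}\; u_k(X,\tilde Q_{-k})+\mathrm{Tr}\{D_k^{\mathcal H}X\},$$ or the $X$-component of a solution of the semidefinite program $$\text{(P5)}\qquad \min_{X\succeq 0,\;T,\;\theta\ge 0}\;\mathrm{Tr}\{T\}-\mathrm{Tr}\{D_k^{\mathcal H}X\}\quad\text{s.t.}\quad \mathrm{Tr}\{X\}\le p_k,\quad \begin{bmatrix}H_{k,k}XH_{k,k}^{\mathcal H}+R_{k,k}&R_{k,k}^{1/2}\\R_{k,k}^{1/2}&T\end{bmatrix}\succeq0,$$ $$\begin{bmatrix}\theta I-I_L\otimes X&-\mathrm{vec}(X^{\mathcal H}\widehat G_k^{\mathcal H})\\-\mathrm{vec}(X^{\mathcal H}\widehat G_k^{\mathcal H})^{\mathcal H}&\iota_k-\epsilon_k^2\theta-\mathrm{Tr}\{\widehat G_kX\widehat G_k^{\mathcal H}\}\end{bmatrix}\succeq0,$$ with $R_{k,k}$ evaluated at $\tilde Q$. Theorem. If every matrix $H_{k,k}$, $k=1,\dots,K$, has full column rank, then every limit point (limit of a convergent subsequence) of the sequence $(Q^{(n)})_{n\ge0}$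 generated by this algorithm is a stationary point of (P3). -/

import Mathlib

open scoped Kronecker MatrixOrder ComplexOrder
open Matrix Filter Topology

noncomputable section

/-- The data of a MIMO cognitive radio network with `K` transmitter-receiver pairs; pair `k` has
`M k` transmit and `N k` receive antennas, and the primary receiver has `L` antennas.
`H k j` is the channel from transmitter `j` to receiver `k`, `Ghat k` the estimated channel from
transmitter `k` to the primary receiver, `σ k` the noise standard deviation at receiver `k`, `ε k`
the radius of the uncertainty region, `p k` the power budget and `ι k` the interference budget. -/
structure CRNetwork (K L : ℕ) (M N : Fin K → ℕ) where
  H : ∀ k j : Fin K, Matrix (Fin (N k)) (Fin (M j)) ℂ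
  Ghat : ∀ k : Fin K, Matrix (Fin L) (Fin (M k)) ℂ
  σ : Fin K → ℝ
  σ_pos : ∀ k, 0 < σ k
  ε : Fin K → ℝ
  ε_pos : ∀ k, 0 < ε k
  p : Fin K → ℝ
  ι : Fin K → ℝ

namespace CRNetwork

/-- A tuple `(Q_1, …, Q_K)` of complex square matrices, `Q_k` of size `M k`. -/
abbrev Profile {K : ℕ} (M : Fin K → ℕ) : Type :=
  ∀ k : Fin K, Matrix (Fin (M k)) (Fin (M k)) ℂ

variable {K L : ℕ} {M N : Fin K → ℕ} (S : CRNetwork K L M N)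

/-- `V_k = H_{kk} Q_k H_{kk}ᴴ`. -/
def V (Q : Profile M) (k : Fin K) : Matrix (Fin (N k)) (Fin (N k)) ℂ :=
  S.H k k * Q k * (S.H k k)ᴴ

/-- Interference plus noise covariance, `R_{kk} = ∑_{i ≠ k} H_{ki} Q_i H_{ki}ᴴ + σ_k² I`. -/
def R (Q : Profile M) (k : Fin K) : Matrix (Fin (N k)) (Fin (N k)) ℂ :=
  ∑ i ∈ Finset.univ.erase k, S.H k i * Q i * (S.H k i)ᴴ + (S.σ k ^ 2 : ℝ) • 1

/-- `B_k = ∑_i H_{ki} Q_i H_{ki}ᴴ + σ_k² I`. -/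
def B (Q : Profile M) (k : Fin K) : Matrix (Fin (N k)) (Fin (N k)) ℂ :=
  ∑ i, S.H k i * Q i * (S.H k i)ᴴ + (S.σ k ^ 2 : ℝ) • 1

/-- The utility of link `k`, `u_k(Q) = Tr{H_{kk} Q_k H_{kk}ᴴ (H_{kk} Q_k H_{kk}ᴴ + R_{kk})⁻¹}`
(the trace is real on tuples of positive semidefinite matrices). -/
def u (k : Fin K) (Q : Profile M) : ℝ :=
  (trace (S.V Q k * (S.V Q k + S.R Q k)⁻¹)).re

/-- The sum utility, i.e. the objective of the robust sum-MSE problem (to be maximized). -/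
def U (Q : Profile M) : ℝ := ∑ k, S.u k Q

/-- The feasible set of block `k`: positive semidefinite matrices which satisfy the power
constraint, and the interference constraint for every channel error of Frobenius norm `≤ ε_k`. -/
def feasible (k : Fin K) : Set (Matrix (Fin (M k)) (Fin (M k)) ℂ) :=
  {X | X.PosSemidef ∧ (trace X).re ≤ S.p k ∧
    ∀ Δ : Matrix (Fin L) (Fin (M k)) ℂ, (trace (Δ * Δᴴ)).re ≤ S.ε k ^ 2 →
      (trace ((S.Ghat k + Δ) * X * (S.Ghat k + Δ)ᴴ)).re ≤ S.ι k}

/-- The complex gradient at `Q`, with respect to block `k`, of `f_k = ∑_{j ≠ k} u_j`: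
`D_k = -∑_{j ≠ k} H_{jk}ᴴ B_j⁻¹ V_j B_j⁻¹ H_{jk}`. -/
def D (k : Fin K) (Q : Profile M) : Matrix (Fin (M k)) (Fin (M k)) ℂ :=
  -∑ j ∈ Finset.univ.erase k,
    (S.H j k)ᴴ * (S.B Q j)⁻¹ * S.V Q j * (S.B Q j)⁻¹ * S.H j k

/-- The objective of the block subproblem at the current point `Q`, as a function of the new block
`X`: `u_k(X, Q_{-k}) + Tr{D_kᴴ X}`, with `f_k` linearized at `Q`. -/
def surrogate (k : Fin K) (Q : Profile M) (X : Matrix (Fin (M k)) (Fin (M k)) ℂ) : ℝ :=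
  S.u k (Function.update Q k X) + (trace ((S.D k Q)ᴴ * X)).re

/-- `X` solves the concave block subproblem for block `k` at the current point `Q`. -/
def SolvesBlock (k : Fin K) (Q : Profile M) (X : Matrix (Fin (M k)) (Fin (M k)) ℂ) : Prop :=
  X ∈ S.feasible k ∧ ∀ Y ∈ S.feasible k, S.surrogate k Q Y ≤ S.surrogate k Q X

/-- The linear matrix inequality in `(X, θ)` that encodes the robust interference constraint. -/
def robustLMI (k : Fin K) (X : Matrix (Fin (M k)) (Fin (M k)) ℂ) (θ : ℝ) :
    Matrix ((Fin L × Fin (M k)) ⊕ Unit) ((Fin L × Fin (M k)) ⊕ Unit) ℂ :=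
  fromBlocks
    ((θ : ℂ) • 1 - (1 : Matrix (Fin L) (Fin L) ℂ) ⊗ₖ X)
    (-replicateCol Unit (vec (Xᴴ * (S.Ghat k)ᴴ)))
    (-(replicateCol Unit (vec (Xᴴ * (S.Ghat k)ᴴ)))ᴴ)
    (((S.ι k : ℂ) - (S.ε k : ℂ) ^ 2 * (θ : ℂ) - trace (S.Ghat k * X * (S.Ghat k)ᴴ)) • 1)

/-- The Schur complement matrix of the semidefinite program, with `R_{kk}^{1/2}` the positive
semidefinite square root. -/
def schurLMI (k : Fin K) (Q : Profile M) (X : Matrix (Fin (M k)) (Fin (M k)) ℂ)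
    (T : Matrix (Fin (N k)) (Fin (N k)) ℂ) :
    Matrix (Fin (N k) ⊕ Fin (N k)) (Fin (N k) ⊕ Fin (N k)) ℂ :=
  fromBlocks (S.H k k * X * (S.H k k)ᴴ + S.R Q k) (CFC.sqrt (S.R Q k)) (CFC.sqrt (S.R Q k)) T

/-- Feasibility of `(X, T, θ)` in the semidefinite program for block `k` at the point `Q`. -/
def SDPFeasible (k : Fin K) (Q : Profile M) (X : Matrix (Fin (M k)) (Fin (M k)) ℂ)
    (T : Matrix (Fin (N k)) (Fin (N k)) ℂ) (θ : ℝ) : Prop :=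
  X.PosSemidef ∧ 0 ≤ θ ∧ (trace X).re ≤ S.p k ∧
    (S.schurLMI k Q X T).PosSemidef ∧ (S.robustLMI k X θ).PosSemidef

/-- The objective `Tr{T} - Tr{D_kᴴ X}` of the semidefinite program (to be minimized). -/
def sdpObjective (k : Fin K) (Q : Profile M) (X : Matrix (Fin (M k)) (Fin (M k)) ℂ)
    (T : Matrix (Fin (N k)) (Fin (N k)) ℂ) : ℝ :=
  (trace T).re - (trace ((S.D k Q)ᴴ * X)).re

/-- `X` is the covariance component of an optimal solution `(X, T, θ)` of the semidefinite program
for block `k` at the current point `Q`. -/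
def SolvesBlockSDP (k : Fin K) (Q : Profile M) (X : Matrix (Fin (M k)) (Fin (M k)) ℂ) : Prop :=
  ∃ T θ, S.SDPFeasible k Q X T θ ∧
    ∀ X' T' θ', S.SDPFeasible k Q X' T' θ' → S.sdpObjective k Q X T ≤ S.sdpObjective k Q X' T'

/-- The point at which block `k` is updated in a sweep that goes from `Q` to `Q'`:
`(Q'_1, …, Q'_{k-1}, Q_k, …, Q_K)`. -/
def sweepPoint (Q Q' : Profile M) (k : Fin K) : Profile M :=
  fun j => if j < k then Q' j else Q j

/-- `Q 0, Q 1, Q 2, …` is generated by the cyclic block coordinate ascent algorithm with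
concave-convex procedure: it starts at a feasible point, and in each sweep the blocks are updated
in cyclic order, each by a solution of the block subproblem or of its semidefinite program, with
`f_k` linearized at the current point. -/
def IsBlockAscentSequence (Q : ℕ → Profile M) : Prop :=
  (∀ k, Q 0 k ∈ S.feasible k) ∧
  ∀ n k,
    S.SolvesBlock k (sweepPoint (Q n) (Q (n + 1)) k) (Q (n + 1) k) ∨
    S.SolvesBlockSDP k (sweepPoint (Q n) (Q (n + 1)) k) (Q (n + 1) k)

/-- The real-linear functional `Y ↦ Re Tr{Gᴴ Y}`. -/
def reTraceCLM {m : ℕ} (G : Matrix (Fin m) (Fin m) ℂ) : Matrix (Fin m) (Fin m) ℂ →L[ℝ] ℝ where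
  toFun Y := (trace (Gᴴ * Y)).re
  map_add' X Y := by simp [mul_add]
  map_smul' c Y := by simp
  cont := by fun_prop

/-- `G` is the gradient at `Q` of the sum utility with respect to block `k`, for the real inner
product `Re Tr{Gᴴ Y}` (Fréchet derivative). -/
def IsBlockGradient (k : Fin K) (Q : Profile M) (G : Matrix (Fin (M k)) (Fin (M k)) ℂ) : Prop :=
  HasFDerivAt (fun X => S.U (Function.update Q k X)) (reTraceCLM G) (Q k)

/-- `Q` is a stationary point of the robust sum-MSE problem: it is feasible, and satisfies the
first-order optimality condition `Re Tr{∇_k U(Q)ᴴ (X - Q_k)} ≤ 0` for all `k` and all feasible `X`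
in block `k`. -/
def IsStationary (Q : Profile M) : Prop :=
  (∀ k, Q k ∈ S.feasible k) ∧
  ∀ k, ∃ G, S.IsBlockGradient k Q G ∧
    ∀ X ∈ S.feasible k, (trace (Gᴴ * (X - Q k))).re ≤ 0

end CRNetwork

end

/-!
Write `E = H_{jk} (X - Q_k) H_{jk}ᴴ` for the change of `B_j` when block `k` moves from `Q_k` to `X`.
As `u_k = N_k - Re Tr{R_k B_k⁻¹}`, and `R_k`, `V_j` (`j ≠ k`) do not depend on block `k`, every
utility depends on block `k` only through an inverse, and the resolvent identity
`B'⁻¹ = B⁻¹ - B⁻¹ E B⁻¹ + B⁻¹ E B'⁻¹ E B⁻¹` gives all that is needed about it. To first order it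
yields the gradient of `U` (`CRNetwork.isBlockGradient`). The sign of the remainder shows that `u_j`
is convex in block `k` for `j ≠ k` (`CRNetwork.u_update_of_ne_ge`), and that `u_k` is concave in it,
strictly so because `E ≠ 0` when `H_{kk}` has full column rank (`CRNetwork.u_update_self_lt`).
Hence the surrogate minorizes `U` up to a constant, with contact at the current block
(`CRNetwork.surrogate_sub_le`), and each block subproblem has at most one solution
(`CRNetwork.SolvesBlock.unique`).

The semidefinite program is the same subproblem (`CRNetwork.SolvesBlockSDP.solvesBlock`): a Schur
complement eliminates `T`, and the linear matrix inequality for the robust constraint is lossless by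
the S-procedure, proved here from the optimality conditions for the maximum of a convex quadratic on
a ball (`exists_trustRegion_multiplier`).

So `U` increases at every update. Let `Qbar` be a limit point. The feasible sets are compact, so
along a further subsequence the next iterates converge too, say to `Q'`. By monotonicity `U` takes
the constant value `lim U` along the limiting sweep from `Qbar` to `Q'`; at each of its points the
new block `Q'_k` solves the subproblem, and so does the old block `Qbar_k`, as the surrogate
minorizes `U`. By uniqueness `Q' = Qbar`, so every `Qbar_k` solves its subproblem at `Qbar`
(`CRNetwork.IsBlockAscentSequence.solvesBlock_of_tendsto`). The surrogate and `U` have the same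
gradient there, and the first-order condition for the subproblem is stationarity.
-/

/-! ### Trace inequalities and the resolvent identity -/

section MatrixLemmas

variable {n : Type*} [Fintype n]

theorem Matrix.PosSemidef.trace_re_nonneg {A : Matrix n n ℂ} (hA : A.PosSemidef) :
    0 ≤ (trace A).re :=
  (Complex.nonneg_iff.mp hA.trace_nonneg).1

variable [DecidableEq n]

theorem Matrix.PosSemidef.exists_eq_conjTranspose_mul_self {A : Matrix n n ℂ}
    (hA : A.PosSemidef) : ∃ C : Matrix n n ℂ, A = Cᴴ * C :=
  CStarAlgebra.nonneg_iff_eq_star_mul_self.mp hA.nonneg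

theorem Matrix.PosSemidef.re_trace_mul_nonneg {A P : Matrix n n ℂ} (hA : A.PosSemidef)
    (hP : P.PosSemidef) : 0 ≤ (trace (A * P)).re := by
  obtain ⟨C, rfl⟩ := hA.exists_eq_conjTranspose_mul_self
  rw [Matrix.mul_assoc, trace_mul_comm]
  exact (hP.mul_mul_conjTranspose_same C).trace_re_nonneg

theorem Matrix.PosDef.eq_zero_of_re_trace_mul_nonpos {A P : Matrix n n ℂ} (hA : A.PosDef)
    (hP : P.PosSemidef) (h : (trace (A * P)).re ≤ 0) : P = 0 := by
  obtain ⟨C, rfl⟩ := hA.posSemidef.exists_eq_conjTranspose_mul_self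
  have hC : IsUnit C := isUnit_of_mul_isUnit_right hA.isUnit
  rw [Matrix.mul_assoc, trace_mul_comm] at h
  have hS := hP.mul_mul_conjTranspose_same C
  have h0 : C * P * Cᴴ = 0 := by
    rw [← hS.trace_eq_zero_iff]
    have := Complex.nonneg_iff.mp hS.trace_nonneg
    exact Complex.ext (le_antisymm h this.1) this.2.symm
  have h1 := hC.mul_left_cancel (a := C) (b := P * Cᴴ) (c := 0) (by
    rw [← Matrix.mul_assoc, h0, mul_zero])
  exact hC.star.mul_right_cancel (a := P) (b := star C) (c := 0) (by
    rw [star_eq_conjTranspose, h1, zero_mul])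

/-- Resolvent identity to second order. For Hermitian `B`, `B'` the remainder is a congruence of
`B'⁻¹`, hence has a sign. -/
theorem Matrix.inv_eq_second_order {B B' : Matrix n n ℂ} (hB : IsUnit B) (hB' : IsUnit B') :
    B'⁻¹ = B⁻¹ - B⁻¹ * (B' - B) * B⁻¹ + B⁻¹ * (B' - B) * B'⁻¹ * (B' - B) * B⁻¹ := by
  have h1 : B'⁻¹ - B⁻¹ = B'⁻¹ * (B - B') * B⁻¹ := inv_sub_inv (by simp [hB, hB'])
  have h2 : B⁻¹ - B'⁻¹ = B⁻¹ * (B' - B) * B'⁻¹ := inv_sub_inv (by simp [hB, hB'])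
  have h3 : B⁻¹ * (B' - B) * B'⁻¹ * (B' - B) * B⁻¹
      = (B⁻¹ - B'⁻¹) * (B' - B) * B⁻¹ := by rw [h2]
  rw [h3, sub_mul, sub_mul]
  have h4 : B'⁻¹ * (B' - B) * B⁻¹ = -(B'⁻¹ - B⁻¹) := by rw [h1]; noncomm_ring
  rw [h4]; abel

theorem Matrix.continuousAt_inv_of_isUnit {B : Matrix n n ℂ} (hB : IsUnit B) :
    ContinuousAt (fun X : Matrix n n ℂ => X⁻¹) B := by
  refine continuousAt_matrix_inv B ?_
  have hd : B.det ≠ 0 := ((isUnit_iff_isUnit_det B).mp hB).ne_zero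
  simpa [Ring.inverse_eq_inv'] using continuousAt_inv₀ hd

/-- A matrix of full column rank is cancellable in `H X Hᴴ`. -/
theorem Matrix.eq_zero_of_mul_mul_conjTranspose_eq_zero {a b : ℕ}
    {H : Matrix (Fin a) (Fin b) ℂ} (hH : H.rank = b) {X : Matrix (Fin b) (Fin b) ℂ}
    (hX : H * X * Hᴴ = 0) : X = 0 := by
  have hinj : Function.Injective H.mulVec := by
    rw [mulVec_injective_iff, linearIndependent_iff_card_eq_finrank_span, Fintype.card_fin]
    rw [rank_eq_finrank_span_cols] at hH
    exact hH.symm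
  have hU : IsUnit (Hᴴ * H) := (PosDef.conjTranspose_mul_self H hinj).isUnit
  have h : (Hᴴ * H) * X * (Hᴴ * H) = 0 := by
    calc (Hᴴ * H) * X * (Hᴴ * H) = Hᴴ * (H * X * Hᴴ) * H := by simp only [Matrix.mul_assoc]
      _ = 0 := by rw [hX]; simp
  exact hU.mul_left_cancel (by rw [hU.mul_right_cancel (h.trans (zero_mul _).symm), mul_zero])

end MatrixLemmas

/-! ### Expansion of the utilities in one block -/

namespace CRNetwork

variable {K L : ℕ} {M N : Fin K → ℕ} (S : CRNetwork K L M N)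

theorem V_add_R (Q : Profile M) (k : Fin K) : S.V Q k + S.R Q k = S.B Q k := by
  unfold V R B
  rw [← Finset.add_sum_erase _ _ (Finset.mem_univ k), add_assoc]

theorem V_update_self (Q : Profile M) (k : Fin K) (X : Matrix (Fin (M k)) (Fin (M k)) ℂ) :
    S.V (Function.update Q k X) k = S.H k k * X * (S.H k k)ᴴ := by
  simp [V]

theorem V_update_of_ne (Q : Profile M) {j k : Fin K} (h : j ≠ k)
    (X : Matrix (Fin (M k)) (Fin (M k)) ℂ) :
    S.V (Function.update Q k X) j = S.V Q j := by
  simp [V, Function.update_of_ne h]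

theorem R_update_self (Q : Profile M) (k : Fin K) (X : Matrix (Fin (M k)) (Fin (M k)) ℂ) :
    S.R (Function.update Q k X) k = S.R Q k := by
  unfold R
  congr 1
  refine Finset.sum_congr rfl fun i hi => ?_
  rw [Function.update_of_ne (Finset.ne_of_mem_erase hi)]

theorem B_update (Q : Profile M) (j k : Fin K) (X : Matrix (Fin (M k)) (Fin (M k)) ℂ) :
    S.B (Function.update Q k X) j = S.B Q j + S.H j k * (X - Q k) * (S.H j k)ᴴ := by
  unfold B
  rw [← Finset.add_sum_erase _ _ (Finset.mem_univ k),
    ← Finset.add_sum_erase _ _ (Finset.mem_univ k), Function.update_self]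
  rw [Finset.sum_congr rfl (g := fun i => S.H j i * Q i * (S.H j i)ᴴ) fun i hi => by
    rw [Function.update_of_ne (Finset.ne_of_mem_erase hi)]]
  rw [Matrix.mul_sub, Matrix.sub_mul]
  abel

theorem V_posSemidef {Q : Profile M} (hQ : ∀ j, (Q j).PosSemidef) (k : Fin K) :
    (S.V Q k).PosSemidef :=
  (hQ k).mul_mul_conjTranspose_same _

theorem R_posDef {Q : Profile M} (hQ : ∀ j, (Q j).PosSemidef) (k : Fin K) :
    (S.R Q k).PosDef := by
  refine PosDef.posSemidef_add
    (posSemidef_sum _ fun i _ => (hQ i).mul_mul_conjTranspose_same _) ?_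
  exact PosDef.one.smul (pow_pos (S.σ_pos k) 2)

theorem B_posDef {Q : Profile M} (hQ : ∀ j, (Q j).PosSemidef) (k : Fin K) :
    (S.B Q k).PosDef := by
  rw [← V_add_R]
  exact (S.R_posDef hQ k).posSemidef_add (S.V_posSemidef hQ k)

theorem update_posSemidef {Q : Profile M} (hQ : ∀ j, (Q j).PosSemidef) {k : Fin K}
    {X : Matrix (Fin (M k)) (Fin (M k)) ℂ} (hX : X.PosSemidef) (j : Fin K) :
    (Function.update Q k X j).PosSemidef := by
  rcases eq_or_ne j k with rfl | h
  · simpa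
  · simpa [Function.update_of_ne h] using hQ j

theorem u_eq (Q : Profile M) (k : Fin K) :
    S.u k Q = (trace (S.V Q k * (S.B Q k)⁻¹)).re := by
  rw [u, V_add_R]

/-- Where `B_k` is invertible, `u_k = N_k - Re Tr{R_k B_k⁻¹}`, which depends on block `k` only
through `B_k⁻¹`. -/
theorem u_eq_sub {Q : Profile M} {k : Fin K} (hB : IsUnit (S.B Q k)) :
    S.u k Q = N k - (trace (S.R Q k * (S.B Q k)⁻¹)).re := by
  have h : S.V Q k = S.B Q k - S.R Q k := eq_sub_of_add_eq (S.V_add_R Q k)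
  rw [u_eq, h, Matrix.sub_mul, mul_nonsing_inv _ ((isUnit_iff_isUnit_det _).mp hB)]
  simp

/-- The difference quotient of `u_k` in its own block: `u_k` moves by `Re Tr` of this matrix against
the increment of the block. -/
noncomputable def ownSlope (k : Fin K) (Q : Profile M) (X : Matrix (Fin (M k)) (Fin (M k)) ℂ) :
    Matrix (Fin (M k)) (Fin (M k)) ℂ :=
  (S.H k k)ᴴ * (S.B (Function.update Q k X) k)⁻¹ * S.R Q k * (S.B Q k)⁻¹ * S.H k k

/-- The difference quotient of `u_j` in block `k ≠ j`. -/
noncomputable def crossSlope (j k : Fin K) (Q : Profile M) (X : Matrix (Fin (M k)) (Fin (M k)) ℂ) :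
    Matrix (Fin (M k)) (Fin (M k)) ℂ :=
  -((S.H j k)ᴴ * (S.B (Function.update Q k X) j)⁻¹ * S.V Q j * (S.B Q j)⁻¹ * S.H j k)

/-- Trace form of the resolvent identity `B'⁻¹ - B⁻¹ = -B⁻¹ (B' - B) B'⁻¹`. -/
theorem trace_mul_inv_sub {a b : ℕ} {B B' W : Matrix (Fin a) (Fin a) ℂ}
    {H : Matrix (Fin a) (Fin b) ℂ} {Y : Matrix (Fin b) (Fin b) ℂ}
    (hB : IsUnit B) (hB' : IsUnit B') (hE : B' = B + H * Y * Hᴴ) :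
    trace (W * B'⁻¹) - trace (W * B⁻¹) = -trace (Hᴴ * B'⁻¹ * W * B⁻¹ * H * Y) := by
  have h2 : B⁻¹ - B'⁻¹ = B⁻¹ * (B' - B) * B'⁻¹ := inv_sub_inv (by simp [hB, hB'])
  have h3 : B' - B = H * Y * Hᴴ := by rw [hE]; abel
  rw [← neg_sub, ← trace_sub, ← Matrix.mul_sub, h2, h3]
  congr 1
  calc trace (W * (B⁻¹ * (H * Y * Hᴴ) * B'⁻¹))
      = trace ((W * B⁻¹ * H * Y) * (Hᴴ * B'⁻¹)) := by simp only [Matrix.mul_assoc]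
    _ = _ := by rw [trace_mul_comm]; simp only [Matrix.mul_assoc]

theorem u_update_self_sub {k : Fin K} {Q : Profile M} {X : Matrix (Fin (M k)) (Fin (M k)) ℂ}
    (hB : IsUnit (S.B Q k)) (hB' : IsUnit (S.B (Function.update Q k X) k)) :
    S.u k (Function.update Q k X) - S.u k Q = (trace (S.ownSlope k Q X * (X - Q k))).re := by
  have h := trace_mul_inv_sub (W := S.R Q k) hB hB' (S.B_update Q k k X)
  rw [S.u_eq_sub hB, S.u_eq_sub hB', R_update_self, ownSlope]
  have h' := congrArg Complex.re h
  simp only [Complex.sub_re, Complex.neg_re] at h'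
  linarith

theorem u_update_of_ne_sub {j k : Fin K} (hjk : j ≠ k) {Q : Profile M}
    {X : Matrix (Fin (M k)) (Fin (M k)) ℂ}
    (hB : IsUnit (S.B Q j)) (hB' : IsUnit (S.B (Function.update Q k X) j)) :
    S.u j (Function.update Q k X) - S.u j Q = (trace (S.crossSlope j k Q X * (X - Q k))).re := by
  have h := trace_mul_inv_sub (W := S.V Q j) hB hB' (S.B_update Q j k X)
  rw [u_eq, u_eq, V_update_of_ne _ _ hjk, crossSlope, Matrix.neg_mul, trace_neg, ← h,
    Complex.sub_re]

/-- Trace form of the second-order resolvent identity. -/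
theorem trace_mul_inv_second_order {a b : ℕ} {B B' W : Matrix (Fin a) (Fin a) ℂ}
    {H : Matrix (Fin a) (Fin b) ℂ} {Y : Matrix (Fin b) (Fin b) ℂ}
    (hB : IsUnit B) (hB' : IsUnit B') (hE : B' = B + H * Y * Hᴴ) :
    trace (W * B'⁻¹) = trace (W * B⁻¹) - trace (Hᴴ * B⁻¹ * W * B⁻¹ * H * Y)
      + trace (W * (B⁻¹ * (H * Y * Hᴴ) * B'⁻¹ * (H * Y * Hᴴ) * B⁻¹)) := by
  have h3 : B' - B = H * Y * Hᴴ := by rw [hE]; abel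
  conv_lhs => rw [inv_eq_second_order hB hB', h3]
  rw [Matrix.mul_add, Matrix.mul_sub, trace_add, trace_sub]
  congr 2
  calc trace (W * (B⁻¹ * (H * Y * Hᴴ) * B⁻¹))
      = trace ((W * B⁻¹ * H * Y) * (Hᴴ * B⁻¹)) := by simp only [Matrix.mul_assoc]
    _ = _ := by rw [trace_mul_comm]; simp only [Matrix.mul_assoc]

theorem remainder_posSemidef {a : ℕ} {B B' E : Matrix (Fin a) (Fin a) ℂ}
    (hB : B.IsHermitian) (hB' : B'.PosDef) (hE : E.IsHermitian) :
    (B⁻¹ * E * B'⁻¹ * E * B⁻¹).PosSemidef := by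
  have h := hB'.inv.posSemidef.mul_mul_conjTranspose_same (B⁻¹ * E)
  rwa [conjTranspose_mul, hE.eq, hB.inv.eq, ← Matrix.mul_assoc] at h

theorem eq_zero_of_remainder_eq_zero {a : ℕ} {B B' E : Matrix (Fin a) (Fin a) ℂ}
    (hB : B.PosDef) (hB' : B'.PosDef) (hE : E.IsHermitian)
    (h : B⁻¹ * E * B'⁻¹ * E * B⁻¹ = 0) : E = 0 := by
  obtain ⟨C, hC⟩ := hB'.inv.posSemidef.exists_eq_conjTranspose_mul_self
  have hCu : IsUnit C := isUnit_of_mul_isUnit_right (hC ▸ hB'.inv.isUnit)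
  have h0 : (C * (E * B⁻¹))ᴴ * (C * (E * B⁻¹)) = 0 := by
    rw [conjTranspose_mul, conjTranspose_mul, hE.eq, hB.isHermitian.inv.eq]
    calc B⁻¹ * E * Cᴴ * (C * (E * B⁻¹)) = B⁻¹ * E * (Cᴴ * C) * E * B⁻¹ := by
          simp only [Matrix.mul_assoc]
      _ = 0 := by rw [← hC, h]
  rw [conjTranspose_mul_self_eq_zero] at h0
  have h1 := hCu.mul_left_cancel (h0.trans (mul_zero _).symm)
  exact hB.inv.isUnit.mul_right_cancel (h1.trans (zero_mul _).symm)

theorem congr_isHermitian {a b : ℕ} (H : Matrix (Fin a) (Fin b) ℂ) {X Y : Matrix (Fin b) (Fin b) ℂ}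
    (hX : X.PosSemidef) (hY : Y.PosSemidef) : (H * (X - Y) * Hᴴ).IsHermitian :=
  isHermitian_mul_mul_conjTranspose _ (hX.isHermitian.sub hY.isHermitian)

/-- `u_j`, `j ≠ k`, is convex in block `k`: it lies above its linearization. -/
theorem u_update_of_ne_ge {j k : Fin K} (hjk : j ≠ k) {Q : Profile M}
    (hQ : ∀ i, (Q i).PosSemidef) {X : Matrix (Fin (M k)) (Fin (M k)) ℂ} (hX : X.PosSemidef) :
    S.u j Q + (trace (S.crossSlope j k Q (Q k) * (X - Q k))).re
      ≤ S.u j (Function.update Q k X) := by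
  have hB := S.B_posDef hQ j
  have hB' := S.B_posDef (update_posSemidef hQ hX) j
  have h := trace_mul_inv_second_order (W := S.V Q j) hB.isUnit hB'.isUnit (S.B_update Q j k X)
  have hP := (S.V_posSemidef hQ j).re_trace_mul_nonneg
    (remainder_posSemidef hB.isHermitian hB' (congr_isHermitian (S.H j k) hX (hQ k)))
  rw [u_eq, u_eq, V_update_of_ne _ _ hjk, crossSlope, Function.update_eq_self, h, Matrix.neg_mul,
    trace_neg, Complex.neg_re, Complex.add_re, Complex.sub_re]
  linarith

/-- `u_k` is strictly concave in block `k` when `H_kk` has full column rank: off the base point it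
lies strictly below its linearization. -/
theorem u_update_self_lt {k : Fin K} (hrank : (S.H k k).rank = M k) {Q : Profile M}
    (hQ : ∀ i, (Q i).PosSemidef) {X : Matrix (Fin (M k)) (Fin (M k)) ℂ} (hX : X.PosSemidef)
    (hne : X ≠ Q k) :
    S.u k (Function.update Q k X) <
      S.u k Q + (trace (S.ownSlope k Q (Q k) * (X - Q k))).re := by
  have hB := S.B_posDef hQ k
  have hB' := S.B_posDef (update_posSemidef hQ hX) k
  have hE := congr_isHermitian (S.H k k) hX (hQ k)
  have h := trace_mul_inv_second_order (W := S.R Q k) hB.isUnit hB'.isUnit (S.B_update Q k k X)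
  by_contra! hcon
  refine hne (sub_eq_zero.mp (eq_zero_of_mul_mul_conjTranspose_eq_zero hrank
    (eq_zero_of_remainder_eq_zero hB hB' hE ((S.R_posDef hQ k).eq_zero_of_re_trace_mul_nonpos
      (remainder_posSemidef hB.isHermitian hB' hE) ?_))))
  rw [S.u_eq_sub hB.isUnit, S.u_eq_sub hB'.isUnit, R_update_self, h, ownSlope,
    Function.update_eq_self, Complex.add_re, Complex.sub_re] at hcon
  linarith

theorem D_conjTranspose {k : Fin K} {Q : Profile M} (hQ : ∀ i, (Q i).PosSemidef) :
    (S.D k Q)ᴴ = ∑ j ∈ Finset.univ.erase k, S.crossSlope j k Q (Q k) := by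
  rw [D, conjTranspose_neg, conjTranspose_sum, ← Finset.sum_neg_distrib]
  refine Finset.sum_congr rfl fun j _ => ?_
  rw [crossSlope, Function.update_eq_self]
  simp only [conjTranspose_mul, conjTranspose_conjTranspose, (S.V_posSemidef hQ j).isHermitian.eq,
    (S.B_posDef hQ j).isHermitian.inv.eq, Matrix.mul_assoc]

theorem U_eq_add (k : Fin K) (Q : Profile M) :
    S.U Q = S.u k Q + ∑ j ∈ Finset.univ.erase k, S.u j Q :=
  (Finset.add_sum_erase _ (fun j => S.u j Q) (Finset.mem_univ k)).symm

/-- The surrogate minorizes the sum utility, with equality at the current block. -/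
theorem surrogate_sub_le {k : Fin K} {Q : Profile M} (hQ : ∀ i, (Q i).PosSemidef)
    {X : Matrix (Fin (M k)) (Fin (M k)) ℂ} (hX : X.PosSemidef) :
    S.surrogate k Q X - S.surrogate k Q (Q k) ≤ S.U (Function.update Q k X) - S.U Q := by
  have h : ∑ j ∈ Finset.univ.erase k, (S.u j Q
      + (trace (S.crossSlope j k Q (Q k) * (X - Q k))).re)
      ≤ ∑ j ∈ Finset.univ.erase k, S.u j (Function.update Q k X) :=
    Finset.sum_le_sum fun j hj => S.u_update_of_ne_ge (Finset.ne_of_mem_erase hj) hQ hX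
  have hD : (trace ((S.D k Q)ᴴ * X)).re - (trace ((S.D k Q)ᴴ * Q k)).re
      = ∑ j ∈ Finset.univ.erase k, (trace (S.crossSlope j k Q (Q k) * (X - Q k))).re := by
    rw [← Complex.sub_re, ← trace_sub, ← Matrix.mul_sub, S.D_conjTranspose hQ, Finset.sum_mul,
      trace_sum, Complex.re_sum]
  rw [Finset.sum_add_distrib] at h
  rw [S.U_eq_add k Q, S.U_eq_add k (Function.update Q k X), surrogate, surrogate,
    Function.update_eq_self]
  linarith

end CRNetwork

/-! ### Differentiability and continuity of the utilities -/

/-- A function whose increment at `X₀` is `Re Tr{Γ(X) (X - X₀)}` with `Γ` continuous at `X₀` has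
gradient `Γ(X₀)ᴴ` (Carathéodory's form of differentiability). -/
theorem hasFDerivAt_of_trace_slope {m : ℕ} {F : Matrix (Fin m) (Fin m) ℂ → ℝ}
    {Γ : Matrix (Fin m) (Fin m) ℂ → Matrix (Fin m) (Fin m) ℂ} {X₀ : Matrix (Fin m) (Fin m) ℂ}
    (hF : ∀ᶠ X in 𝓝 X₀, F X - F X₀ = (trace (Γ X * (X - X₀))).re) (hΓ : ContinuousAt Γ X₀) :
    HasFDerivAt F (CRNetwork.reTraceCLM (Γ X₀)ᴴ) X₀ := by
  let _ : NormedAddCommGroup (Matrix (Fin m) (Fin m) ℂ) := Matrix.normedAddCommGroup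
  let _ : NormedSpace ℝ (Matrix (Fin m) (Fin m) ℂ) := Matrix.normedSpace
  refine HasFDerivAt.of_isLittleO ?_
  have key : (fun X : Matrix (Fin m) (Fin m) ℂ => ∑ i, ∑ j, (Γ X i j - Γ X₀ i j) * (X - X₀) j i)
      =o[𝓝 X₀] fun X => X - X₀ := by
    suffices h : ∀ i j, (fun X : Matrix (Fin m) (Fin m) ℂ => (Γ X i j - Γ X₀ i j) * (X - X₀) j i)
        =o[𝓝 X₀] fun X => X - X₀ from
      Asymptotics.IsLittleO.fun_sum fun i _ => Asymptotics.IsLittleO.fun_sum fun j _ => h i j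
    intro i j
    have h1 : (fun X => Γ X i j - Γ X₀ i j) =o[𝓝 X₀] fun _ => (1 : ℝ) := by
      rw [Asymptotics.isLittleO_one_iff, tendsto_sub_nhds_zero_iff]
      exact (((continuous_apply_apply i j).continuousAt (x := Γ X₀)).comp hΓ :)
    have h2 : (fun X : Matrix (Fin m) (Fin m) ℂ => (X - X₀) j i) =O[𝓝 X₀] fun X => ‖X - X₀‖ :=
      Asymptotics.IsBigO.of_bound 1 (Eventually.of_forall fun X => by
        rw [one_mul, norm_norm]; exact Matrix.norm_entry_le_entrywise_sup_norm _)
    have h3 := h1.mul_isBigO h2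
    simp only [one_mul] at h3
    exact h3.of_norm_right
  refine Asymptotics.IsLittleO.congr' ((Asymptotics.IsBigO.of_bound 1
    (Eventually.of_forall fun X => ?_)).trans_isLittleO key) (f₁ := fun X =>
      (∑ i, ∑ j, (Γ X i j - Γ X₀ i j) * (X - X₀) j i).re) ?_ EventuallyEq.rfl
  · rw [one_mul]; exact Complex.abs_re_le_norm _
  · filter_upwards [hF] with X hX
    have : ∑ i, ∑ j, (Γ X i j - Γ X₀ i j) * (X - X₀) j i
        = trace ((Γ X - Γ X₀) * (X - X₀)) := by
      simp [trace, Matrix.mul_apply]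
    rw [this, hX, Matrix.sub_mul, trace_sub, Complex.sub_re]
    change _ = _ - ((Γ X₀)ᴴᴴ * (X - X₀)).trace.re
    rw [conjTranspose_conjTranspose]

namespace CRNetwork

variable {K L : ℕ} {M N : Fin K → ℕ} (S : CRNetwork K L M N)

theorem continuous_V (k : Fin K) : Continuous fun Q : Profile M => S.V Q k := by
  unfold V; fun_prop

theorem continuous_B (k : Fin K) : Continuous fun Q : Profile M => S.B Q k := by
  unfold B; fun_prop

theorem continuousAt_B_inv {Q : Profile M} (hQ : ∀ j, (Q j).PosSemidef) (k : Fin K) :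
    ContinuousAt (fun P : Profile M => (S.B P k)⁻¹) Q :=
  ContinuousAt.comp (f := fun P : Profile M => S.B P k)
    (continuousAt_inv_of_isUnit (S.B_posDef hQ k).isUnit) (S.continuous_B k).continuousAt

theorem _root_.ContinuousAt.matrix_mul_complex {α : Type*} [TopologicalSpace α] {x : α} {a b c : ℕ}
    {f : α → Matrix (Fin a) (Fin b) ℂ} {g : α → Matrix (Fin b) (Fin c) ℂ}
    (hf : ContinuousAt f x) (hg : ContinuousAt g x) : ContinuousAt (fun y => f y * g y) x :=
  ContinuousAt.comp (f := fun y => (f y, g y))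
    (g := fun p : Matrix (Fin a) (Fin b) ℂ × Matrix (Fin b) (Fin c) ℂ => p.1 * p.2)
    (by fun_prop : Continuous _).continuousAt (hf.prodMk hg)

theorem _root_.ContinuousAt.re_trace {α : Type*} [TopologicalSpace α] {x : α} {a : ℕ}
    {f : α → Matrix (Fin a) (Fin a) ℂ} (hf : ContinuousAt f x) :
    ContinuousAt (fun y => (trace (f y)).re) x :=
  ContinuousAt.comp (g := fun A : Matrix (Fin a) (Fin a) ℂ => (trace A).re)
    (by fun_prop : Continuous _).continuousAt hf

theorem continuousAt_u {Q : Profile M} (hQ : ∀ j, (Q j).PosSemidef) (k : Fin K) :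
    ContinuousAt (S.u k) Q := by
  simp only [funext (fun Q => S.u_eq Q k)]
  exact ((S.continuous_V k).continuousAt.matrix_mul_complex (S.continuousAt_B_inv hQ k)).re_trace

theorem continuousAt_U {Q : Profile M} (hQ : ∀ j, (Q j).PosSemidef) : ContinuousAt S.U Q :=
  tendsto_finsetSum _ fun k _ => S.continuousAt_u hQ k

theorem continuousAt_D {Q : Profile M} (hQ : ∀ j, (Q j).PosSemidef) (k : Fin K) :
    ContinuousAt (S.D k) Q := by
  refine ContinuousAt.neg (tendsto_finsetSum _ fun j _ => ?_)
  have h := S.continuousAt_B_inv hQ j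
  exact (((continuousAt_const.matrix_mul_complex h).matrix_mul_complex
    (S.continuous_V j).continuousAt).matrix_mul_complex h).matrix_mul_complex continuousAt_const

theorem continuousAt_surrogate {Q : Profile M} (hQ : ∀ j, (Q j).PosSemidef) {k : Fin K}
    {X : Matrix (Fin (M k)) (Fin (M k)) ℂ} (hX : X.PosSemidef) :
    ContinuousAt (fun p : Profile M × Matrix (Fin (M k)) (Fin (M k)) ℂ =>
      S.surrogate k p.1 p.2) (Q, X) := by
  refine ContinuousAt.add ?_ (ContinuousAt.re_trace (ContinuousAt.matrix_mul_complex ?_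
    continuousAt_snd))
  · exact ContinuousAt.comp (g := S.u k)
      (f := fun p : Profile M × Matrix (Fin (M k)) (Fin (M k)) ℂ => Function.update p.1 k p.2)
      (S.continuousAt_u (update_posSemidef hQ hX) k)
      (continuous_fst.update k continuous_snd).continuousAt
  · exact (continuous_id.matrix_conjTranspose.continuousAt).comp
      (ContinuousAt.comp (g := S.D k)
      (f := fun p : Profile M × Matrix (Fin (M k)) (Fin (M k)) ℂ => p.1) (x := (Q, X))
      (S.continuousAt_D hQ k) continuousAt_fst)

theorem continuousAt_B_update_inv {Q : Profile M} (hQ : ∀ i, (Q i).PosSemidef) (j k : Fin K) :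
    ContinuousAt (fun X => (S.B (Function.update Q k X) j)⁻¹) (Q k) :=
  ContinuousAt.comp (g := fun P : Profile M => (S.B P j)⁻¹) (f := fun X => Function.update Q k X)
    (by rw [Function.update_eq_self]; exact S.continuousAt_B_inv hQ j)
    (continuous_const.update k continuous_id).continuousAt

theorem continuousAt_ownSlope {Q : Profile M} (hQ : ∀ i, (Q i).PosSemidef) (k : Fin K) :
    ContinuousAt (S.ownSlope k Q) (Q k) :=
  (((continuousAt_const.matrix_mul_complex (S.continuousAt_B_update_inv hQ k k)).matrix_mul_complex
    continuousAt_const).matrix_mul_complex continuousAt_const).matrix_mul_complex continuousAt_const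

theorem continuousAt_crossSlope {Q : Profile M} (hQ : ∀ i, (Q i).PosSemidef) (j k : Fin K) :
    ContinuousAt (S.crossSlope j k Q) (Q k) :=
  ((((continuousAt_const.matrix_mul_complex (S.continuousAt_B_update_inv hQ j k)).matrix_mul_complex
    continuousAt_const).matrix_mul_complex continuousAt_const).matrix_mul_complex
    continuousAt_const).neg

theorem eventually_isUnit_B_update {Q : Profile M} (hQ : ∀ i, (Q i).PosSemidef) (k : Fin K) :
    ∀ᶠ X in 𝓝 (Q k), ∀ j, IsUnit (S.B (Function.update Q k X) j) := by
  rw [eventually_all]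
  intro j
  have hc : Continuous fun X => (S.B (Function.update Q k X) j).det :=
    ((S.continuous_B j).comp (continuous_const.update k continuous_id)).matrix_det
  have h0 : (S.B (Function.update Q k (Q k)) j).det ≠ 0 := by
    rw [Function.update_eq_self]; exact (S.B_posDef hQ j).det_pos.ne'
  filter_upwards [hc.continuousAt.eventually_ne h0] with X hX
  exact (isUnit_iff_isUnit_det _).mpr (isUnit_iff_ne_zero.mpr hX)

/-- At positive semidefinite tuples the gradient of `U` in block `k` is the gradient of `u_k` plus
`D_k`. -/
theorem isBlockGradient {Q : Profile M} (hQ : ∀ i, (Q i).PosSemidef) (k : Fin K) :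
    S.IsBlockGradient k Q (S.ownSlope k Q (Q k) + (S.D k Q)ᴴ)ᴴ := by
  rw [S.D_conjTranspose hQ]
  refine hasFDerivAt_of_trace_slope (Γ := fun X => S.ownSlope k Q X +
    ∑ j ∈ Finset.univ.erase k, S.crossSlope j k Q X) ?_
    ((S.continuousAt_ownSlope hQ k).add
      (tendsto_finsetSum _ fun j _ => S.continuousAt_crossSlope hQ j k))
  filter_upwards [S.eventually_isUnit_B_update hQ k] with X hX
  rw [Function.update_eq_self, S.U_eq_add k, S.U_eq_add k Q, add_sub_add_comm,
    ← Finset.sum_sub_distrib, Matrix.add_mul, trace_add, Complex.add_re, Finset.sum_mul, trace_sum,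
    Complex.re_sum, S.u_update_self_sub (S.B_posDef hQ k).isUnit (hX k)]
  congr 1
  exact Finset.sum_congr rfl fun j hj =>
    S.u_update_of_ne_sub (Finset.ne_of_mem_erase hj) (S.B_posDef hQ j).isUnit (hX j)

end CRNetwork

/-! ### Feasible sets and the block subproblem -/

namespace CRNetwork

variable {K L : ℕ} {M N : Fin K → ℕ} (S : CRNetwork K L M N)

theorem convex_feasible (k : Fin K) : Convex ℝ (S.feasible k) := by
  intro X hX Y hY a b ha hb hab
  have h (p q c : ℝ) (hp : p ≤ c) (hq : q ≤ c) : a * p + b * q ≤ c := by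
    calc a * p + b * q ≤ a * c + b * c := by gcongr
      _ = c := by rw [← add_mul, hab, one_mul]
  refine ⟨(hX.1.smul ha).add (hY.1.smul hb), ?_, fun Δ hΔ => ?_⟩
  · simpa using h _ _ _ hX.2.1 hY.2.1
  · have h' := h _ _ _ (hX.2.2 Δ hΔ) (hY.2.2 Δ hΔ)
    generalize S.Ghat k + Δ = G at h' ⊢
    simpa [Matrix.mul_add, Matrix.add_mul] using h'

theorem isClosed_posSemidef (m : ℕ) : IsClosed {X : Matrix (Fin m) (Fin m) ℂ | X.PosSemidef} := by
  simp only [posSemidef_iff_dotProduct_mulVec, Set.ofPred_and, Set.ofPred_forall, IsHermitian]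
  refine (isClosed_eq (by fun_prop) continuous_id).inter (isClosed_iInter fun x => ?_)
  exact isClosed_le continuous_const (by fun_prop)

theorem isClosed_feasible (k : Fin K) : IsClosed (S.feasible k) := by
  unfold feasible
  simp only [Set.ofPred_and, Set.ofPred_forall]
  refine (isClosed_posSemidef _).inter ((isClosed_le (by fun_prop) continuous_const).inter
    (isClosed_iInter fun Δ => isClosed_iInter fun _ => isClosed_le (by fun_prop) continuous_const))

/-- Frobenius balls are compact. -/
theorem isCompact_re_trace_conjTranspose_mul_self_le (a b : ℕ) (c : ℝ) :
    IsCompact {C : Matrix (Fin a) (Fin b) ℂ | (trace (Cᴴ * C)).re ≤ c} := by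
  have hc : IsCompact {C : Matrix (Fin a) (Fin b) ℂ |
      ∀ i j, C i j ∈ Metric.closedBall (0 : ℂ) (√c)} :=
    IsCompact.matrix (isCompact_closedBall _ _)
  refine hc.of_isClosed_subset (isClosed_le (by fun_prop) continuous_const) fun C hC i j => ?_
  rw [mem_closedBall_zero_iff]
  refine Real.le_sqrt_of_sq_le (le_trans ?_ hC)
  have h : (trace (Cᴴ * C)).re = ∑ t, ∑ s, ‖C s t‖ ^ 2 := by
    simp only [trace, diag, Matrix.mul_apply, conjTranspose_apply, Complex.re_sum]
    refine Finset.sum_congr rfl fun t _ => Finset.sum_congr rfl fun s _ => ?_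
    rw [Complex.star_def, ← Complex.normSq_eq_conj_mul_self, Complex.ofReal_re,
      Complex.normSq_eq_norm_sq]
  rw [h]
  calc ‖C i j‖ ^ 2 ≤ ∑ s, ‖C s j‖ ^ 2 :=
        Finset.single_le_sum (f := fun s => ‖C s j‖ ^ 2) (fun _ _ => by positivity)
          (Finset.mem_univ i)
    _ ≤ _ := Finset.single_le_sum (f := fun t => ∑ s, ‖C s t‖ ^ 2)
          (fun _ _ => by positivity) (Finset.mem_univ j)

/-- Positive semidefinite matrices of bounded trace are the matrices `Cᴴ C` with `C` in a Frobenius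
ball. -/
theorem isCompact_feasible (k : Fin K) : IsCompact (S.feasible k) := by
  refine ((isCompact_re_trace_conjTranspose_mul_self_le (M k) (M k) (S.p k)).image
    (f := fun C => Cᴴ * C) (by fun_prop)).of_isClosed_subset (S.isClosed_feasible k) ?_
  intro X hX
  obtain ⟨C, rfl⟩ := hX.1.exists_eq_conjTranspose_mul_self
  exact ⟨C, hX.2.1, rfl⟩

/-- Strict concavity of `u_k` in its own block makes the solution of the subproblem unique. -/
theorem SolvesBlock.unique {k : Fin K} (hrank : (S.H k k).rank = M k) {Q : Profile M}
    (hQ : ∀ i, (Q i).PosSemidef) {X Y : Matrix (Fin (M k)) (Fin (M k)) ℂ}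
    (hX : S.SolvesBlock k Q X) (hY : S.SolvesBlock k Q Y) : X = Y := by
  by_contra hne
  set Z : Matrix (Fin (M k)) (Fin (M k)) ℂ := (1 / 2 : ℝ) • X + (1 / 2 : ℝ) • Y with hZ
  have hZf : Z ∈ S.feasible k :=
    S.convex_feasible k hX.1 hY.1 (by norm_num) (by norm_num) (by norm_num)
  have h2 : (2 : ℝ) • Z = X + Y := by
    rw [hZ, smul_add, smul_smul, smul_smul]; norm_num
  have hXZ : X - Z = -(Y - Z) := by
    rw [two_smul] at h2
    rw [neg_sub, sub_eq_sub_iff_add_eq_add, ← h2]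
  have hXne : X ≠ Z := fun h => by
    rw [h, sub_self, eq_comm, neg_eq_zero, sub_eq_zero] at hXZ
    exact hne (h.trans hXZ.symm)
  have hYne : Y ≠ Z := fun h => by
    rw [h, sub_self, neg_zero, sub_eq_zero] at hXZ
    exact hne (hXZ.trans h.symm)
  have hP := update_posSemidef hQ (k := k) hZf.1
  have h3 := S.u_update_self_lt hrank hP hX.1.1 (by simpa using hXne)
  have h4 := S.u_update_self_lt hrank hP hY.1.1 (by simpa using hYne)
  simp only [Function.update_idem, Function.update_self] at h3 h4
  rw [hXZ, Matrix.mul_neg, trace_neg, Complex.neg_re] at h3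
  have h5 := hX.2 Z hZf
  have h6 := hY.2 Z hZf
  have h7 : 2 * (trace ((S.D k Q)ᴴ * Z)).re
      = (trace ((S.D k Q)ᴴ * X)).re + (trace ((S.D k Q)ᴴ * Y)).re := by
    rw [← Complex.add_re, ← trace_add, ← Matrix.mul_add, ← h2]
    simp
  unfold surrogate at h5 h6
  linarith

/-- If the current block already solves its subproblem, it satisfies the first-order optimality
condition of the original problem, since the surrogate and `U` have the same gradient there. -/
theorem SolvesBlock.first_order {k : Fin K} {Q : Profile M} (hQ : ∀ i, (Q i).PosSemidef)
    (h : S.SolvesBlock k Q (Q k)) {X : Matrix (Fin (M k)) (Fin (M k)) ℂ} (hX : X ∈ S.feasible k) :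
    (trace ((S.ownSlope k Q (Q k) + (S.D k Q)ᴴ) * (X - Q k))).re ≤ 0 := by
  have hline : Tendsto (fun t : ℝ => Q k + t • (X - Q k)) (𝓝[>] 0) (𝓝 (Q k)) := by
    have hc : Continuous fun t : ℝ => Q k + t • (X - Q k) := by fun_prop
    simpa using (hc.tendsto 0).mono_left nhdsWithin_le_nhds
  have hc : ContinuousAt
      (fun Y => (trace ((S.ownSlope k Q Y + (S.D k Q)ᴴ) * (X - Q k))).re) (Q k) :=
    ContinuousAt.re_trace (ContinuousAt.matrix_mul_complex
      ((S.continuousAt_ownSlope hQ k).add continuousAt_const) continuousAt_const)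
  refine le_of_tendsto (hc.tendsto.comp hline) ?_
  filter_upwards [Ioo_mem_nhdsGT (zero_lt_one' ℝ)] with t ht
  have hf : Q k + t • (X - Q k) ∈ S.feasible k :=
    (S.convex_feasible k).add_smul_sub_mem h.1 hX ⟨ht.1.le, ht.2.le⟩
  have h1 := h.2 _ hf
  have h2 := S.u_update_self_sub (S.B_posDef hQ k).isUnit
    (S.B_posDef (update_posSemidef hQ hf.1) k).isUnit
  unfold surrogate at h1
  rw [Function.update_eq_self] at h1
  have h3 : t * (trace ((S.ownSlope k Q (Q k + t • (X - Q k)) + (S.D k Q)ᴴ) *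
      (X - Q k))).re ≤ 0 := by
    rw [add_sub_cancel_left, Matrix.mul_smul, trace_smul, Complex.smul_re, smul_eq_mul] at h2
    rw [Matrix.mul_add, trace_add, Complex.add_re, Matrix.mul_smul, trace_smul, Complex.smul_re,
      smul_eq_mul] at h1
    rw [Matrix.add_mul, trace_add, Complex.add_re, mul_add]
    linarith
  exact nonpos_of_mul_nonpos_right h3 ht.1

theorem isStationary_of_solvesBlock {Q : Profile M} (h : ∀ k, S.SolvesBlock k Q (Q k)) :
    S.IsStationary Q := by
  have hQ : ∀ i, (Q i).PosSemidef := fun i => (h i).1.1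
  refine ⟨fun k => (h k).1, fun k => ⟨_, S.isBlockGradient hQ k, fun X hX => ?_⟩⟩
  rw [conjTranspose_conjTranspose]
  exact (h k).first_order S hQ hX

end CRNetwork

/-! ### The trust-region multiplier -/

/-- Trust-region optimality, the lossless S-procedure for a convex quadratic on a ball: if
`y₀` maximizes `a y y + 2 b y` on the ball `ip y y ≤ ε²`, then some multiplier `θ ≥ 0` satisfies
`a ≤ θ ip` and turns the bound on the ball into a global one. The hypothesis `hg` names the Riesz
representative `g` of half the derivative at `y₀`. -/
theorem exists_trustRegion_multiplier {V : Type*} [AddCommGroup V] [Module ℝ V]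
    {ip a : V →ₗ[ℝ] V →ₗ[ℝ] ℝ} {b : V →ₗ[ℝ] ℝ} {ε : ℝ} (hε : 0 < ε)
    (ip_symm : ∀ x y, ip x y = ip y x) (ip_nonneg : ∀ x, 0 ≤ ip x x)
    (ip_definite : ∀ x, ip x x = 0 → x = 0)
    (a_symm : ∀ x y, a x y = a y x) (a_nonneg : ∀ x, 0 ≤ a x x) {y₀ g : V}
    (hg : ∀ v, a y₀ v + b v = ip g v) (hy₀ : ip y₀ y₀ ≤ ε ^ 2)
    (hmax : ∀ y, ip y y ≤ ε ^ 2 → a y y + 2 * b y ≤ a y₀ y₀ + 2 * b y₀) :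
    ∃ θ : ℝ, 0 ≤ θ ∧ (∀ z, a z z ≤ θ * ip z z) ∧
      ∀ y, a y y + 2 * b y + θ * (ε ^ 2 - ip y y) ≤ a y₀ y₀ + 2 * b y₀ := by
  have hexp (y : V) : a y y + 2 * b y
      = a y₀ y₀ + 2 * b y₀ + 2 * ip g (y - y₀) + a (y - y₀) (y - y₀) := by
    rw [← hg]
    simp only [map_sub, LinearMap.sub_apply, a_symm y y₀]
    ring
  -- The equality case of Cauchy-Schwarz: `g` is a nonnegative multiple of `y₀`.
  obtain ⟨θ, hθ, hgθ, hslack⟩ : ∃ θ : ℝ, 0 ≤ θ ∧ g = θ • y₀ ∧ θ * ip y₀ y₀ = θ * ε ^ 2 := by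
    rcases eq_or_ne g 0 with h0 | h0
    · exact ⟨0, le_rfl, by simp [h0], by simp⟩
    have hgg : 0 < ip g g := (ip_nonneg g).lt_of_ne' fun h => h0 (ip_definite g h)
    set r := √(ip g g) with hr
    have hr0 : 0 < r := Real.sqrt_pos.mpr hgg
    have hr2 : ip g g = r ^ 2 := (Real.sq_sqrt hgg.le).symm
    have hball : ip ((ε / r) • g) ((ε / r) • g) = ε ^ 2 := by
      simp only [map_smul, LinearMap.smul_apply, smul_eq_mul, hr2]
      field_simp
    have h1 : ε * r ≤ ip g y₀ := by
      have h2 := hmax _ hball.le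
      rw [hexp] at h2
      have h3 := a_nonneg ((ε / r) • g - y₀)
      have h4 : ip g ((ε / r) • g - y₀) = ε * r - ip g y₀ := by
        simp only [map_sub, map_smul, smul_eq_mul, hr2]
        field_simp
      linarith
    have h5 : y₀ - (ε / r) • g = 0 := by
      refine ip_definite _ (le_antisymm ?_ (ip_nonneg _))
      have h6 : ip (y₀ - (ε / r) • g) (y₀ - (ε / r) • g)
          = ip y₀ y₀ + ε ^ 2 - 2 * (ε / r) * ip g y₀ := by
        rw [← hball]
        simp only [map_sub, map_smul, LinearMap.sub_apply, LinearMap.smul_apply, smul_eq_mul,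
          ip_symm y₀ g]
        ring
      have h7 : ε ^ 2 ≤ ε / r * ip g y₀ := by
        calc ε ^ 2 = ε / r * (ε * r) := by field_simp
          _ ≤ _ := by gcongr
      rw [h6]
      linarith
    have h8 : y₀ = (ε / r) • g := sub_eq_zero.mp h5
    refine ⟨r / ε, by positivity, ?_, ?_⟩
    · rw [h8, smul_smul]
      field_simp
      simp
    · rw [h8, hball]
  have hid (y : V) : a y y + 2 * b y + θ * (ε ^ 2 - ip y y)
      = a y₀ y₀ + 2 * b y₀ - (θ * ip (y - y₀) (y - y₀) - a (y - y₀) (y - y₀)) := by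
    rw [hexp, hgθ, mul_sub, ← hslack]
    simp only [map_sub, map_smul, LinearMap.sub_apply, LinearMap.smul_apply, smul_eq_mul,
      ip_symm y y₀]
    ring
  have hle : ∀ z, a z z ≤ θ * ip z z := by
    intro z
    rcases hθ.eq_or_lt with rfl | hθ
    · -- All displacements from `y₀` inside the ball are null for `a`; use the parallelogram law.
      have hball (y : V) (hy : ip y y ≤ ε ^ 2) : a (y - y₀) (y - y₀) ≤ 0 := by
        have h1 := hid y
        have h2 := hmax y hy
        linarith
      obtain ⟨δ, hδ, hδz⟩ : ∃ δ : ℝ, 0 < δ ∧ δ ^ 2 * ip z z ≤ ε ^ 2 := by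
        refine ⟨ε / √(ip z z + 1), by have := ip_nonneg z; positivity, ?_⟩
        have := ip_nonneg z
        rw [div_pow, Real.sq_sqrt (by positivity), div_mul_eq_mul_div, div_le_iff₀ (by positivity)]
        nlinarith [sq_nonneg ε]
      have h1 := hball (δ • z) (by
        simp only [map_smul, LinearMap.smul_apply, smul_eq_mul]; linarith)
      have h2 := hball (-(δ • z)) (by
        simp only [map_neg, map_smul, LinearMap.neg_apply, LinearMap.smul_apply, smul_eq_mul]
        linarith)
      simp only [map_sub, map_neg, map_smul, LinearMap.sub_apply, LinearMap.neg_apply,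
        LinearMap.smul_apply, smul_eq_mul] at h1 h2
      have h3 := a_nonneg y₀
      have h4 : δ ^ 2 * a z z ≤ 0 := by linarith
      nlinarith [sq_pos_of_pos hδ]
    · have hy₀' : ip y₀ y₀ = ε ^ 2 := mul_left_cancel₀ hθ.ne' hslack
      -- A line through `y₀` not tangent to the sphere meets it in a second point.
      have htrans (w : V) (hw : ip y₀ w ≠ 0) : a w w ≤ θ * ip w w := by
        have hww : ip w w ≠ 0 := fun h => hw (by rw [ip_definite w h, map_zero])
        set t := -2 * ip y₀ w / ip w w with ht
        have ht0 : t ≠ 0 := div_ne_zero (mul_ne_zero (by norm_num) hw) hww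
        have htw : t * ip w w = -2 * ip y₀ w := div_mul_cancel₀ _ hww
        have hs : ip (y₀ + t • w) (y₀ + t • w) = ε ^ 2 := by
          simp only [map_add, map_smul, LinearMap.add_apply, LinearMap.smul_apply, smul_eq_mul,
            ip_symm w y₀, hy₀', htw]
          ring
        have h1 := hid (y₀ + t • w)
        have h2 := hmax (y₀ + t • w) hs.le
        rw [hs, sub_self, mul_zero, add_zero] at h1
        simp only [add_sub_cancel_left, map_smul, LinearMap.smul_apply, smul_eq_mul] at h1
        have h3 : 0 < t ^ 2 := by positivity
        by_contra! h4
        have h5 := mul_lt_mul_of_pos_left h4 h3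
        linarith
      by_cases hz : ip y₀ z = 0
      · have hlim : Tendsto (fun δ : ℝ => θ * ip (z + δ • y₀) (z + δ • y₀)
            - a (z + δ • y₀) (z + δ • y₀)) (𝓝[>] 0) (𝓝 (θ * ip z z - a z z)) := by
          simp only [map_add, map_smul, LinearMap.add_apply, LinearMap.smul_apply, smul_eq_mul]
          refine Tendsto.mono_left (Continuous.tendsto' (by fun_prop) _ _ ?_) nhdsWithin_le_nhds
          simp
        refine sub_nonneg.mp (ge_of_tendsto hlim ?_)
        filter_upwards [self_mem_nhdsWithin] with δ (hδ : 0 < δ)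
        refine sub_nonneg.mpr (htrans _ ?_)
        rw [map_add, map_smul, hz, hy₀', smul_eq_mul, zero_add]
        positivity
      · exact htrans z hz
  refine ⟨θ, hθ, hle, fun y => ?_⟩
  rw [hid y]
  linarith [hle (y - y₀)]

/-! ### Equivalence of the semidefinite program with the block subproblem -/

theorem Matrix.re_trace_conjTranspose {n : Type*} [Fintype n] (A : Matrix n n ℂ) :
    (trace Aᴴ).re = (trace A).re := by
  rw [trace_conjTranspose, Complex.star_def, Complex.conj_re]

/-- The real bilinear form `Re Tr{Aᴴ X B}`; for `X = 1` it is the real Frobenius inner product. -/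
noncomputable def Matrix.reTraceForm {a : ℕ} (b : ℕ) (X : Matrix (Fin a) (Fin a) ℂ) :
    Matrix (Fin a) (Fin b) ℂ →ₗ[ℝ] Matrix (Fin a) (Fin b) ℂ →ₗ[ℝ] ℝ :=
  LinearMap.mk₂ ℝ (fun A B => (trace (Aᴴ * X * B)).re)
    (fun A A' B => by simp [Matrix.add_mul]) (fun c A B => by simp)
    (fun A B B' => by simp [Matrix.mul_add]) (fun c A B => by simp)

theorem Matrix.reTraceForm_apply {a b : ℕ} (X : Matrix (Fin a) (Fin a) ℂ)
    (A B : Matrix (Fin a) (Fin b) ℂ) : reTraceForm b X A B = (trace (Aᴴ * X * B)).re := rfl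

theorem Matrix.reTraceForm_symm {a b : ℕ} {X : Matrix (Fin a) (Fin a) ℂ} (hX : X.IsHermitian)
    (A B : Matrix (Fin a) (Fin b) ℂ) : reTraceForm b X A B = reTraceForm b X B A := by
  rw [reTraceForm_apply, reTraceForm_apply, ← re_trace_conjTranspose]
  simp [hX.eq, Matrix.mul_assoc]

theorem Matrix.reTraceForm_nonneg {a b : ℕ} {X : Matrix (Fin a) (Fin a) ℂ} (hX : X.PosSemidef)
    (A : Matrix (Fin a) (Fin b) ℂ) : 0 ≤ reTraceForm b X A A :=
  (hX.conjTranspose_mul_mul_same A).trace_re_nonneg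

namespace CRNetwork

variable {K L : ℕ} {M N : Fin K → ℕ} (S : CRNetwork K L M N)

theorem re_trace_perturbed {k : Fin K} {X : Matrix (Fin (M k)) (Fin (M k)) ℂ}
    (hX : X.IsHermitian) (Y : Matrix (Fin (M k)) (Fin L) ℂ) :
    (trace ((S.Ghat k + Yᴴ) * X * (S.Ghat k + Yᴴ)ᴴ)).re
      = (trace (S.Ghat k * X * (S.Ghat k)ᴴ)).re
        + (reTraceForm L X Y Y + 2 * (trace (S.Ghat k * X * Y)).re) := by
  have h : (trace (Yᴴ * X * (S.Ghat k)ᴴ)).re = (trace (S.Ghat k * X * Y)).re := by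
    rw [← re_trace_conjTranspose]; simp [hX.eq, Matrix.mul_assoc]
  rw [conjTranspose_add, conjTranspose_conjTranspose, Matrix.add_mul, Matrix.add_mul,
    Matrix.mul_add, Matrix.mul_add]
  simp only [trace_add, Complex.add_re, h, reTraceForm_apply]
  ring

/-- The S-procedure for the robust interference constraint is lossless: the ball of channel errors
is compact and has interior (`ε_k > 0`), and the interference power is convex in the error. -/
theorem exists_multiplier_of_mem_feasible {k : Fin K} {X : Matrix (Fin (M k)) (Fin (M k)) ℂ}
    (hX : X ∈ S.feasible k) :
    ∃ θ : ℝ, 0 ≤ θ ∧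
      (∀ Z : Matrix (Fin (M k)) (Fin L) ℂ, (trace (Zᴴ * X * Z)).re ≤ θ * (trace (Zᴴ * Z)).re) ∧
      ∀ Y : Matrix (Fin (M k)) (Fin L) ℂ,
        (trace ((S.Ghat k + Yᴴ) * X * (S.Ghat k + Yᴴ)ᴴ)).re
          + θ * (S.ε k ^ 2 - (trace (Yᴴ * Y)).re) ≤ S.ι k := by
  have hip (A B : Matrix (Fin (M k)) (Fin L) ℂ) : reTraceForm L 1 A B = (trace (Aᴴ * B)).re := by
    rw [reTraceForm_apply, Matrix.mul_one]
  have hbound (Y : Matrix (Fin (M k)) (Fin L) ℂ) (hY : (trace (Yᴴ * Y)).re ≤ S.ε k ^ 2) :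
      (trace ((S.Ghat k + Yᴴ) * X * (S.Ghat k + Yᴴ)ᴴ)).re ≤ S.ι k :=
    hX.2.2 Yᴴ (by rwa [conjTranspose_conjTranspose])
  obtain ⟨y₀, hy₀, hmax⟩ := (isCompact_re_trace_conjTranspose_mul_self_le (M k) L
    (S.ε k ^ 2)).exists_isMaxOn ⟨0, by simpa using sq_nonneg (S.ε k)⟩
    (f := fun Y => (trace ((S.Ghat k + Yᴴ) * X * (S.Ghat k + Yᴴ)ᴴ)).re) (by fun_prop)
  let b : Matrix (Fin (M k)) (Fin L) ℂ →ₗ[ℝ] ℝ :=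
    { toFun := fun Y => (trace (S.Ghat k * X * Y)).re
      map_add' := fun A B => by simp [Matrix.mul_add]
      map_smul' := fun c A => by simp }
  have hb (Y) : b Y = (trace (S.Ghat k * X * Y)).re := rfl
  obtain ⟨θ, hθ, h1, h2⟩ := exists_trustRegion_multiplier (ip := reTraceForm L 1)
    (a := reTraceForm L X) (b := b) (S.ε_pos k) (reTraceForm_symm isHermitian_one)
    (reTraceForm_nonneg .one)
    (fun Y hY => by
      rw [hip] at hY
      have h0 := Complex.nonneg_iff.mp (posSemidef_conjTranspose_mul_self Y).trace_nonneg
      exact trace_conjTranspose_mul_self_eq_zero_iff.mp (Complex.ext hY h0.2.symm))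
    (reTraceForm_symm hX.1.isHermitian) (reTraceForm_nonneg hX.1)
    (y₀ := y₀) (g := X * y₀ + X * (S.Ghat k)ᴴ)
    (fun v => by
      rw [hip, hb, reTraceForm_apply, conjTranspose_add, conjTranspose_mul, conjTranspose_mul,
        conjTranspose_conjTranspose, hX.1.isHermitian.eq, Matrix.add_mul, trace_add,
        Complex.add_re])
    (by rw [hip]; exact hy₀)
    (fun Y hY => by
      have h := isMaxOn_iff.mp hmax Y (show (trace (Yᴴ * Y)).re ≤ S.ε k ^ 2 by rwa [← hip])
      rw [S.re_trace_perturbed hX.1.isHermitian, S.re_trace_perturbed hX.1.isHermitian] at h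
      exact le_of_add_le_add_left h)
  refine ⟨θ, hθ, fun Z => by simpa only [hip, reTraceForm_apply] using h1 Z, fun Y => ?_⟩
  have h3 := h2 Y
  have h4 := hbound y₀ hy₀
  rw [S.re_trace_perturbed hX.1.isHermitian] at h4 ⊢
  rw [hip] at h3
  simp only [hb] at h3
  linarith

theorem robustLMI_form {k : Fin K} {X : Matrix (Fin (M k)) (Fin (M k)) ℂ} (hX : X.IsHermitian)
    (θ : ℝ) (Y : Matrix (Fin (M k)) (Fin L) ℂ) (s : ℂ) :
    star (Sum.elim (vec Y) fun _ : Unit => s) ⬝ᵥ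
        (S.robustLMI k X θ *ᵥ Sum.elim (vec Y) fun _ : Unit => s)
      = θ * trace (Yᴴ * Y) - trace (Yᴴ * X * Y) - s * trace (Yᴴ * X * (S.Ghat k)ᴴ)
        - star s * trace (S.Ghat k * X * Y)
        + star s * s * (S.ι k - S.ε k ^ 2 * θ - trace (S.Ghat k * X * (S.Ghat k)ᴴ)) := by
  have hcol (v : Fin L × Fin (M k) → ℂ) :
      replicateCol Unit v *ᵥ (fun _ : Unit => s) = s • v := by
    ext i; simp [mulVec, dotProduct, mul_comm]
  have hrow (v w : Fin L × Fin (M k) → ℂ) :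
      (replicateCol Unit v)ᴴ *ᵥ w = fun _ : Unit => star v ⬝ᵥ w := by
    ext i; simp [mulVec, dotProduct]
  have hstar : star (Sum.elim (vec Y) fun _ : Unit => s)
      = Sum.elim (star (vec Y)) fun _ : Unit => star s := by
    ext i; cases i <;> rfl
  have hunit : (fun _ : Unit => star s) ⬝ᵥ (fun _ : Unit => s) = star s * s := by
    simp [dotProduct]
  rw [hstar, robustLMI, fromBlocks_mulVec, sumElim_dotProduct_sumElim]
  simp only [Sum.elim_comp_inl, Sum.elim_comp_inr, sub_mulVec, smul_mulVec, one_mulVec, neg_mulVec,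
    hcol, hrow, kronecker_mulVec_vec, dotProduct_add, dotProduct_sub, dotProduct_neg,
    dotProduct_smul, star_vec_dotProduct_vec, transpose_one, Matrix.mul_one, conjTranspose_mul,
    conjTranspose_conjTranspose, hX.eq, smul_eq_mul, hunit, ← Matrix.mul_assoc]
  simp [dotProduct]
  ring

/-- For the error `Δ = Yᴴ`, the quadratic form of the LMI at `(vec Y, 1)` is the slack of the
interference constraint minus `θ` times the slack of the ball. -/
theorem re_robustLMI_form_one {k : Fin K} {X : Matrix (Fin (M k)) (Fin (M k)) ℂ}
    (hX : X.IsHermitian) (θ : ℝ) (Y : Matrix (Fin (M k)) (Fin L) ℂ) :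
    (star (Sum.elim (vec Y) fun _ : Unit => (1 : ℂ)) ⬝ᵥ
        (S.robustLMI k X θ *ᵥ Sum.elim (vec Y) fun _ : Unit => (1 : ℂ))).re
      = S.ι k - (trace ((S.Ghat k + Yᴴ) * X * (S.Ghat k + Yᴴ)ᴴ)).re
        - θ * (S.ε k ^ 2 - (trace (Yᴴ * Y)).re) := by
  have h : (trace (Yᴴ * X * (S.Ghat k)ᴴ)).re = (trace (S.Ghat k * X * Y)).re := by
    rw [← re_trace_conjTranspose]; simp [hX.eq, Matrix.mul_assoc]
  rw [S.robustLMI_form hX, S.re_trace_perturbed hX, reTraceForm_apply]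
  simp only [star_one, one_mul, Complex.add_re, Complex.sub_re, Complex.re_ofReal_mul, h,
    ← Complex.ofReal_pow, Complex.ofReal_re]
  ring

theorem robustLMI_isHermitian {k : Fin K} {X : Matrix (Fin (M k)) (Fin (M k)) ℂ}
    (hX : X.IsHermitian) (θ : ℝ) : (S.robustLMI k X θ).IsHermitian := by
  refine IsHermitian.fromBlocks ?_ (by simp) ?_
  · rw [IsHermitian, conjTranspose_sub, conjTranspose_kronecker, hX.eq]
    simp
  · have h := (isHermitian_mul_mul_conjTranspose (S.Ghat k) hX).eq
    have ht : star (trace (S.Ghat k * X * (S.Ghat k)ᴴ)) = trace (S.Ghat k * X * (S.Ghat k)ᴴ) := by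
      rw [← trace_conjTranspose, h]
    rw [IsHermitian, conjTranspose_smul, star_sub, ht]
    simp

theorem interference_le_of_robustLMI {k : Fin K} {X : Matrix (Fin (M k)) (Fin (M k)) ℂ}
    (hX : X.IsHermitian) {θ : ℝ} (hθ : 0 ≤ θ) (h : (S.robustLMI k X θ).PosSemidef)
    (Δ : Matrix (Fin L) (Fin (M k)) ℂ) (hΔ : (trace (Δ * Δᴴ)).re ≤ S.ε k ^ 2) :
    (trace ((S.Ghat k + Δ) * X * (S.Ghat k + Δ)ᴴ)).re ≤ S.ι k := by
  have h1 := (Complex.nonneg_iff.mp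
    (h.dotProduct_mulVec_nonneg (Sum.elim (vec Δᴴ) fun _ : Unit => (1 : ℂ)))).1
  rw [S.re_robustLMI_form_one hX, conjTranspose_conjTranspose] at h1
  have h2 := mul_nonneg hθ (sub_nonneg.mpr hΔ)
  linarith

theorem exists_robustLMI_of_mem_feasible {k : Fin K} {X : Matrix (Fin (M k)) (Fin (M k)) ℂ}
    (hX : X ∈ S.feasible k) : ∃ θ : ℝ, 0 ≤ θ ∧ (S.robustLMI k X θ).PosSemidef := by
  obtain ⟨θ, hθ, h1, h2⟩ := S.exists_multiplier_of_mem_feasible hX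
  have hH := S.robustLMI_isHermitian hX.1.isHermitian θ
  refine ⟨θ, hθ, .of_dotProduct_mulVec_nonneg hH fun x => ?_⟩
  refine Complex.nonneg_iff.mpr ⟨?_, (hH.im_star_dotProduct_mulVec_self x).symm⟩
  obtain ⟨Y, hY⟩ := vec_bijective.surjective fun i => x (Sum.inl i)
  obtain ⟨s, rfl⟩ : ∃ s, x = Sum.elim (vec Y) fun _ => s :=
    ⟨x (Sum.inr ()), by ext i; rcases i with i | i <;> simp [hY]⟩
  rcases eq_or_ne s 0 with rfl | hs
  · rw [S.robustLMI_form hX.1.isHermitian]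
    simpa using h1 Y
  · -- Homogeneity reduces the form at `(vec Y, s)` to the one at `(vec (s⁻¹ Y), 1)`.
    have hx : (Sum.elim (vec Y) fun _ : Unit => s)
        = s • (Sum.elim (vec (s⁻¹ • Y)) fun _ : Unit => (1 : ℂ)) := by
      ext i
      rcases i with i | i <;> simp [hs]
    rw [hx, star_smul, mulVec_smul, smul_dotProduct, dotProduct_smul, smul_eq_mul, smul_eq_mul,
      ← mul_assoc, Complex.star_def, ← Complex.normSq_eq_conj_mul_self, Complex.re_ofReal_mul,
      S.re_robustLMI_form_one hX.1.isHermitian]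
    have h3 := h2 (s⁻¹ • Y)
    exact mul_nonneg (Complex.normSq_nonneg s) (by linarith)

theorem schurLMI_posSemidef_iff {k : Fin K} {Q : Profile M} (hQ : ∀ i, (Q i).PosSemidef)
    {X : Matrix (Fin (M k)) (Fin (M k)) ℂ} (hX : X.PosSemidef)
    (T : Matrix (Fin (N k)) (Fin (N k)) ℂ) :
    (S.schurLMI k Q X T).PosSemidef ↔
      (T - CFC.sqrt (S.R Q k) * (S.B (Function.update Q k X) k)⁻¹ *
        CFC.sqrt (S.R Q k)).PosSemidef := by
  have hB := S.B_posDef (update_posSemidef hQ hX) k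
  have hBeq : S.H k k * X * (S.H k k)ᴴ + S.R Q k = S.B (Function.update Q k X) k := by
    rw [← V_add_R, V_update_self, R_update_self]
  have hs : (CFC.sqrt (S.R Q k))ᴴ = CFC.sqrt (S.R Q k) :=
    (CFC.sqrt_nonneg (S.R Q k)).posSemidef.isHermitian.eq
  have := hB.isUnit.invertible
  have h := PosDef.fromBlocks₁₁ (CFC.sqrt (S.R Q k)) T hB
  rw [hs] at h
  rwa [schurLMI, hBeq]

theorem re_trace_sqrt_mul {k : Fin K} {Q : Profile M} (hQ : ∀ i, (Q i).PosSemidef)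
    {X : Matrix (Fin (M k)) (Fin (M k)) ℂ} (hX : X.PosSemidef) :
    (trace (CFC.sqrt (S.R Q k) * (S.B (Function.update Q k X) k)⁻¹ * CFC.sqrt (S.R Q k))).re
      = N k - S.u k (Function.update Q k X) := by
  rw [S.u_eq_sub (S.B_posDef (update_posSemidef hQ hX) k).isUnit, trace_mul_comm,
    ← Matrix.mul_assoc, CFC.sqrt_mul_sqrt_self _ (S.R_posDef hQ k).posSemidef.nonneg, R_update_self]
  ring

/-- Eliminating `T` and `θ` from the semidefinite program gives back the block subproblem: `T` is at
least the Schur complement, whose trace is `N_k - u_k`, and the robust LMI is lossless. -/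
theorem SolvesBlockSDP.solvesBlock {k : Fin K} {Q : Profile M} (hQ : ∀ i, (Q i).PosSemidef)
    {X : Matrix (Fin (M k)) (Fin (M k)) ℂ} (h : S.SolvesBlockSDP k Q X) : S.SolvesBlock k Q X := by
  obtain ⟨T, θ, ⟨hX, hθ, hp, hT, hL⟩, hopt⟩ := h
  refine ⟨⟨hX, hp, S.interference_le_of_robustLMI hX.isHermitian hθ hL⟩, fun Y hY => ?_⟩
  obtain ⟨θ', hθ', hL'⟩ := S.exists_robustLMI_of_mem_feasible hY
  have h1 := hopt Y _ θ' ⟨hY.1, hθ', hY.2.1,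
    (S.schurLMI_posSemidef_iff hQ hY.1 _).mpr (by rw [sub_self]; exact .zero), hL'⟩
  have h2 := ((S.schurLMI_posSemidef_iff hQ hX T).mp hT).trace_re_nonneg
  rw [trace_sub, Complex.sub_re, S.re_trace_sqrt_mul hQ hX] at h2
  rw [sdpObjective, sdpObjective, S.re_trace_sqrt_mul hQ hY.1] at h1
  unfold surrogate
  linarith

end CRNetwork

/-! ### Convergence of the cyclic algorithm -/

namespace CRNetwork

variable {K L : ℕ} {M N : Fin K → ℕ} (S : CRNetwork K L M N)

/-- The state of a sweep from `Q` to `Q'` after its first `i` block updates. -/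
def partialSweep (Q Q' : Profile M) (i : ℕ) : Profile M :=
  fun j => if j.val < i then Q' j else Q j

theorem sweepPoint_eq (Q Q' : Profile M) (k : Fin K) :
    sweepPoint Q Q' k = partialSweep Q Q' k :=
  rfl

theorem partialSweep_zero (Q Q' : Profile M) : partialSweep Q Q' 0 = Q := by
  ext j; simp [partialSweep]

theorem partialSweep_last (Q Q' : Profile M) : partialSweep Q Q' K = Q' := by
  ext j; simp [partialSweep]

theorem sweepPoint_self (Q Q' : Profile M) (k : Fin K) : sweepPoint Q Q' k k = Q k := by
  simp [sweepPoint]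

theorem update_sweepPoint (Q Q' : Profile M) (k : Fin K) :
    Function.update (sweepPoint Q Q' k) k (Q' k) = partialSweep Q Q' (k + 1) := by
  funext j
  rcases eq_or_ne j k with rfl | h
  · simp [partialSweep]
  · have : (j : ℕ) ≠ k := fun h' => h (Fin.ext h')
    rw [Function.update_of_ne h]
    simp only [sweepPoint, partialSweep, Fin.lt_def]
    congr 1
    simp only [eq_iff_iff]
    omega

theorem continuous_partialSweep (i : ℕ) :
    Continuous fun p : Profile M × Profile M => partialSweep p.1 p.2 i := by
  refine continuous_pi fun j => ?_
  unfold partialSweep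
  split_ifs <;> fun_prop

theorem partialSweep_mem {Q Q' : Profile M} (hQ : ∀ k, Q k ∈ S.feasible k)
    (hQ' : ∀ k, Q' k ∈ S.feasible k) (i : ℕ) (k : Fin K) :
    partialSweep Q Q' i k ∈ S.feasible k := by
  unfold partialSweep
  split_ifs
  exacts [hQ' k, hQ k]

variable {S}

/-- Every update of the algorithm, in either form, solves the block subproblem. Feasibility of the
current point, which the semidefinite form needs, propagates along each sweep. -/
theorem IsBlockAscentSequence.solvesBlock {Q : ℕ → Profile M} (h : S.IsBlockAscentSequence Q)
    (n : ℕ) : (∀ k, Q n k ∈ S.feasible k) ∧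
      ∀ k, S.SolvesBlock k (sweepPoint (Q n) (Q (n + 1)) k) (Q (n + 1) k) := by
  have step (n : ℕ) (hn : ∀ k, Q n k ∈ S.feasible k) (k : Fin K) :
      S.SolvesBlock k (sweepPoint (Q n) (Q (n + 1)) k) (Q (n + 1) k) := by
    induction k using WellFoundedLT.induction with
    | _ k ih =>
      rcases h.2 n k with h' | h'
      · exact h'
      · refine h'.solvesBlock S fun j => ?_
        unfold sweepPoint
        split_ifs with hj
        exacts [(ih j hj).1.1, (hn j).1]
  induction n with
  | zero => exact ⟨h.1, step 0 h.1⟩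
  | succ n ih =>
    have hn := fun k => (ih.2 k).1
    exact ⟨hn, step (n + 1) hn⟩

theorem IsBlockAscentSequence.monotone_partialSweep {Q : ℕ → Profile M}
    (h : S.IsBlockAscentSequence Q) (n : ℕ) {i j : ℕ} (hij : i ≤ j) (hj : j ≤ K) :
    S.U (partialSweep (Q n) (Q (n + 1)) i) ≤ S.U (partialSweep (Q n) (Q (n + 1)) j) := by
  induction j, hij using Nat.le_induction with
  | base => exact le_rfl
  | succ j _ ih =>
    refine (ih (by omega)).trans ?_
    let k : Fin K := ⟨j, hj⟩
    have hP : ∀ l, (sweepPoint (Q n) (Q (n + 1)) k l).PosSemidef := fun l =>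
      (S.partialSweep_mem (h.solvesBlock n).1 (h.solvesBlock (n + 1)).1 k l).1
    have hk := (h.solvesBlock n).2 k
    have h1 := S.surrogate_sub_le hP hk.1.1
    have h2 := hk.2 (sweepPoint (Q n) (Q (n + 1)) k k)
      (S.partialSweep_mem (h.solvesBlock n).1 (h.solvesBlock (n + 1)).1 k k)
    rw [update_sweepPoint, sweepPoint_eq] at h1
    rw [sweepPoint_eq] at h2
    change S.U (partialSweep (Q n) (Q (n + 1)) k) ≤ S.U (partialSweep (Q n) (Q (n + 1)) (k + 1))
    linarith

theorem IsBlockAscentSequence.monotone {Q : ℕ → Profile M} (h : S.IsBlockAscentSequence Q) :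
    Monotone fun n => S.U (Q n) :=
  monotone_nat_of_le_succ fun n => by
    simpa only [partialSweep_zero, partialSweep_last] using
      h.monotone_partialSweep n (Nat.zero_le K) le_rfl

/-- Solutions of the block subproblem are closed under limits, the feasible set being fixed. -/
theorem SolvesBlock.of_tendsto {k : Fin K} {P : ℕ → Profile M}
    {X : ℕ → Matrix (Fin (M k)) (Fin (M k)) ℂ} {P' : Profile M}
    {X' : Matrix (Fin (M k)) (Fin (M k)) ℂ} (h : ∀ n, S.SolvesBlock k (P n) (X n))
    (hP' : ∀ i, (P' i).PosSemidef) (hP : Tendsto P atTop (𝓝 P')) (hX : Tendsto X atTop (𝓝 X')) :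
    S.SolvesBlock k P' X' := by
  have hX' : X' ∈ S.feasible k :=
    (S.isClosed_feasible k).mem_of_tendsto hX (Eventually.of_forall fun n => (h n).1)
  refine ⟨hX', fun Y hY => ?_⟩
  have hlim {Z : ℕ → Matrix (Fin (M k)) (Fin (M k)) ℂ} {Z' : Matrix (Fin (M k)) (Fin (M k)) ℂ}
      (hZ' : Z'.PosSemidef) (hZ : Tendsto Z atTop (𝓝 Z')) :
      Tendsto (fun n => S.surrogate k (P n) (Z n)) atTop (𝓝 (S.surrogate k P' Z')) :=
    Tendsto.comp (g := fun p : Profile M × Matrix (Fin (M k)) (Fin (M k)) ℂ =>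
      S.surrogate k p.1 p.2) (f := fun n => (P n, Z n)) (y := 𝓝 (P', Z'))
      (S.continuousAt_surrogate hP' hZ') (hP.prodMk_nhds hZ)
  exact le_of_tendsto_of_tendsto' (hlim hY.1 tendsto_const_nhds) (hlim hX'.1 hX)
    fun n => (h n).2 Y hY

/-- At a limit point `Qbar` every block solves its own subproblem. Along a further subsequence the
next iterates converge as well, to `Q'`. As `U` is monotone it is constant along the limiting sweep
from `Qbar` to `Q'`, so at each of its points both the old and the new block are optimal, and they
agree by uniqueness: the limiting sweep does not move. -/
theorem IsBlockAscentSequence.solvesBlock_of_tendsto {Q : ℕ → Profile M}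
    (h : S.IsBlockAscentSequence Q) (hrank : ∀ k, (S.H k k).rank = M k) {Qbar : Profile M}
    {φ : ℕ → ℕ} (hφ : StrictMono φ) (hlim : Tendsto (fun n => Q (φ n)) atTop (𝓝 Qbar))
    (k : Fin K) : S.SolvesBlock k Qbar (Qbar k) := by
  have hmem (n : ℕ) : Q n ∈ Set.univ.pi S.feasible := fun k _ => (h.solvesBlock n).1 k
  have (m : ℕ) : FirstCountableTopology (Matrix (Fin m) (Fin m) ℂ) :=
    inferInstanceAs (FirstCountableTopology (Fin m → Fin m → ℂ))
  obtain ⟨Q', hQ', ψ, hψ, hlim'⟩ :=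
    (isCompact_univ_pi S.isCompact_feasible).tendsto_subseq fun n => hmem (φ n + 1)
  have hQbar : ∀ k, Qbar k ∈ S.feasible k := fun k =>
    (S.isClosed_feasible k).mem_of_tendsto ((tendsto_pi_nhds.mp hlim) k)
      (Eventually.of_forall fun n => (h.solvesBlock _).1 k)
  replace hQ' : ∀ k, Q' k ∈ S.feasible k := fun k => hQ' k (Set.mem_univ k)
  replace hlim : Tendsto (fun n => Q (φ (ψ n))) atTop (𝓝 Qbar) := hlim.comp hψ.tendsto_atTop
  have hsweep (i : ℕ) : Tendsto (fun n => partialSweep (Q (φ (ψ n))) (Q (φ (ψ n) + 1)) i) atTop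
      (𝓝 (partialSweep Qbar Q' i)) :=
    ((continuous_partialSweep i).tendsto (Qbar, Q')).comp (hlim.prodMk_nhds hlim')
  have hφψ : Tendsto (fun n => φ (ψ n)) atTop atTop := hφ.tendsto_atTop.comp hψ.tendsto_atTop
  have hU : Tendsto (fun n => S.U (Q n)) atTop (𝓝 (S.U Qbar)) :=
    (tendsto_iff_tendsto_subseq_of_monotone h.monotone hφψ).mpr
      ((S.continuousAt_U fun j => (hQbar j).1).tendsto.comp hlim)
  have hUsweep (i : ℕ) (hi : i ≤ K) : S.U (partialSweep Qbar Q' i) = S.U Qbar := by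
    refine tendsto_nhds_unique ((S.continuousAt_U fun j =>
      (S.partialSweep_mem hQbar hQ' i j).1).tendsto.comp (hsweep i)) ?_
    refine tendsto_of_tendsto_of_tendsto_of_le_of_le (hU.comp hφψ)
      (hU.comp ((tendsto_add_atTop_nat 1).comp hφψ)) (fun n => ?_) fun n => ?_
    · have h' := h.monotone_partialSweep (φ (ψ n)) (Nat.zero_le i) hi
      rwa [partialSweep_zero] at h'
    · have h' := h.monotone_partialSweep (φ (ψ n)) hi le_rfl
      rwa [partialSweep_last] at h'
  have hmove (k : Fin K) : S.SolvesBlock k (sweepPoint Qbar Q' k) (Q' k) ∧ Q' k = Qbar k := by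
    have hP : ∀ i, (sweepPoint Qbar Q' k i).PosSemidef := fun i =>
      (S.partialSweep_mem hQbar hQ' k i).1
    have hnew : S.SolvesBlock k (sweepPoint Qbar Q' k) (Q' k) :=
      SolvesBlock.of_tendsto (fun n => (h.solvesBlock (φ (ψ n))).2 k) hP (hsweep k)
        ((tendsto_pi_nhds.mp hlim') k)
    have h1 := S.surrogate_sub_le hP (hQ' k).1
    rw [update_sweepPoint, hUsweep _ k.2, sweepPoint_self, sweepPoint_eq, hUsweep _ k.2.le,
      sub_self, ← sweepPoint_eq] at h1
    have hold : S.SolvesBlock k (sweepPoint Qbar Q' k) (Qbar k) :=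
      ⟨hQbar k, fun Y hY => (hnew.2 Y hY).trans (sub_nonpos.mp h1)⟩
    exact ⟨hnew, hnew.unique S (hrank k) hP hold⟩
  have hQQ : Q' = Qbar := funext fun k => (hmove k).2
  have hk := (hmove k).1
  rw [hQQ] at hk
  have hsame : sweepPoint Qbar Qbar k = Qbar := by
    funext j; simp [sweepPoint]
  rwa [hsame] at hk

end CRNetwork

theorem theorem1 {K L : ℕ} {M N : Fin K → ℕ} (S : CRNetwork K L M N)
    (hrank : ∀ k, (S.H k k).rank = M k)
    (Q : ℕ → CRNetwork.Profile M) (hQ : S.IsBlockAscentSequence Q)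
    (Qbar : CRNetwork.Profile M)
    (hlim : ∃ φ : ℕ → ℕ, StrictMono φ ∧ Tendsto (fun n => Q (φ n)) atTop (𝓝 Qbar)) :
    S.IsStationary Qbar := by
  obtain ⟨φ, hφ, hlim⟩ := hlim
  exact S.isStationary_of_solvesBlock (hQ.solvesBlock_of_tendsto hrank hφ hlim)
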